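/- Define polynomials $P_n(x)$ recursively by $P_0(x) := 1$ and $$P_n(x) := \frac{x}{n} \sum_{k=1}^{n} \sigma(k)\, P_{n-k}(x) \qquad (n \ge 1),$$ where $\sigma(k) := \sum_{d \mid k} d$ is the sum of the positive divisors of $k$. Then for every integer $n \ge 2$ and every real $x > 2$, $$x\, P_n(x) > P_{n+1}(x).$$ For $n = 1$ the same inequality, $x\,P_1(x) > P_2(x)$, holds for every real $x > 3$. -/

import Mathlib

/-- The polynomials `P_n(x)`, defined by `P_0 = 1` and
`P_n = (x / n) * ∑_{k=1}^{n} σ(k) P_{n-k}` for `n ≥ 1`. In the second clause `n` is written as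
`n + 1` and the summation index `k` as `k + 1` with `0 ≤ k ≤ n`. -/
noncomputable def partitionPoly : ℕ → Polynomial ℝ
  | 0 => 1
  | n + 1 => Polynomial.C (1 / ((n : ℝ) + 1)) * Polynomial.X *
      ∑ k : Fin (n + 1),
        Polynomial.C ((ArithmeticFunction.sigma 1 ((k : ℕ) + 1) : ℕ) : ℝ) * partitionPoly (n - k)

/-- The defining recursion, evaluated at a real number `x`. -/
theorem partitionPoly_eval_of_pos (n : ℕ) (hn : 1 ≤ n) (x : ℝ) :
    (partitionPoly n).eval x = x / n *
      ∑ k ∈ Finset.Icc 1 n, (ArithmeticFunction.sigma 1 k : ℝ) * (partitionPoly (n - k)).eval x := by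
  obtain ⟨n, rfl⟩ : ∃ m, n = m + 1 := ⟨n - 1, by omega⟩
  rw [partitionPoly, ← Finset.Ico_add_one_right_eq_Icc, Finset.sum_Ico_eq_sum_range]
  simp only [Polynomial.eval_mul, Polynomial.eval_finsetSum, Polynomial.eval_C, Polynomial.eval_X,
    Nat.add_sub_cancel]
  rw [Fin.sum_univ_eq_sum_range (fun k => ((ArithmeticFunction.sigma 1 (k + 1) : ℕ) : ℝ) *
    (partitionPoly (n - k)).eval x) (n + 1)]
  simp only [add_comm 1]
  push_cast
  ring

/-! Put `D_n = x P_n - P_{n+1}`. Subtracting two instances of the recursion gives `(n+2) D_{n+1} = x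
(P_{n+1} - σ(n+2) + ∑_{k=1}^{n+1} σ(k) D_{n+1-k})`, so positivity propagates by strong induction.
Only two low terms can obstruct: `D_0 = 0`, and `D_1 = x(x-3)/2`, which is negative for `2 < x < 3`
but still exceeds `-1`. Hence it suffices that `P_{n+1} ≥ σ(n+2) + σ(n)`. This holds for `x ≥ 2`
because `P_n` grows at least cubically while `σ(k) ≤ k(k+1)/2`; small indices are checked by
explicit values. -/

theorem succ_mul_partitionPoly_eval (n : ℕ) (x : ℝ) :
    ((n : ℝ) + 1) * (partitionPoly (n + 1)).eval x = x *
      ∑ k ∈ Finset.range (n + 1),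
        (ArithmeticFunction.sigma 1 (k + 1) : ℝ) * (partitionPoly (n - k)).eval x := by
  rw [partitionPoly_eval_of_pos (n + 1) (by omega) x, ← Finset.Ico_add_one_right_eq_Icc,
    Finset.sum_Ico_eq_sum_range]
  have h : (n : ℝ) + 1 ≠ 0 := by positivity
  simp only [add_comm 1, Nat.add_sub_cancel, Nat.add_sub_add_right]
  push_cast
  field_simp

theorem partitionPoly_eval_zero (x : ℝ) : (partitionPoly 0).eval x = 1 := by
  simp [partitionPoly]

theorem partitionPoly_eval_one (x : ℝ) : (partitionPoly 1).eval x = x := by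
  have h := succ_mul_partitionPoly_eval 0 x
  simpa [partitionPoly_eval_zero] using h

theorem partitionPoly_eval_two (x : ℝ) : (partitionPoly 2).eval x = x * (x + 3) / 2 := by
  have h := succ_mul_partitionPoly_eval 1 x
  have s2 : ArithmeticFunction.sigma 1 2 = 3 := by decide
  norm_num [Finset.sum_range_succ, partitionPoly_eval_zero, partitionPoly_eval_one, s2] at h
  linarith

theorem partitionPoly_eval_nonneg {x : ℝ} (hx : 0 ≤ x) (n : ℕ) :
    0 ≤ (partitionPoly n).eval x := by
  induction n using Nat.strong_induction_on with
  | _ n ih =>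
    rcases n with _ | n
    · simp [partitionPoly_eval_zero]
    · have h := succ_mul_partitionPoly_eval n x
      have h0 : 0 ≤ ((n : ℝ) + 1) * (partitionPoly (n + 1)).eval x := by
        rw [h]
        exact mul_nonneg hx (Finset.sum_nonneg fun k _ =>
          mul_nonneg (Nat.cast_nonneg _) (ih (n - k) (by omega)))
      exact nonneg_of_mul_nonneg_right h0 (by positivity)

theorem two_mul_sum_le_succ_mul_partitionPoly_eval {x : ℝ} (hx : 2 ≤ x) (n : ℕ) :
    2 * ∑ k ∈ Finset.range (n + 1),
        (ArithmeticFunction.sigma 1 (k + 1) : ℝ) * (partitionPoly (n - k)).eval x ≤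
      ((n : ℝ) + 1) * (partitionPoly (n + 1)).eval x := by
  rw [succ_mul_partitionPoly_eval]
  exact mul_le_mul_of_nonneg_right hx (Finset.sum_nonneg fun k _ =>
    mul_nonneg (Nat.cast_nonneg _) (partitionPoly_eval_nonneg (by linarith) _))

/-- For `x ≥ 2`, the first values of `P_n(x)` are at least those at `x = 2`. -/
theorem partitionPoly_eval_small {x : ℝ} (hx : 2 ≤ x) :
    5 ≤ (partitionPoly 2).eval x ∧ 10 ≤ (partitionPoly 3).eval x ∧
    20 ≤ (partitionPoly 4).eval x ∧ 36 ≤ (partitionPoly 5).eval x ∧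
    65 ≤ (partitionPoly 6).eval x := by
  have s2 : ArithmeticFunction.sigma 1 2 = 3 := by decide
  have s3 : ArithmeticFunction.sigma 1 3 = 4 := by decide
  have s4 : ArithmeticFunction.sigma 1 4 = 7 := by decide
  have s5 : ArithmeticFunction.sigma 1 5 = 6 := by decide
  have s6 : ArithmeticFunction.sigma 1 6 = 12 := by decide
  have h1 := two_mul_sum_le_succ_mul_partitionPoly_eval hx 1
  have h2 := two_mul_sum_le_succ_mul_partitionPoly_eval hx 2
  have h3 := two_mul_sum_le_succ_mul_partitionPoly_eval hx 3
  have h4 := two_mul_sum_le_succ_mul_partitionPoly_eval hx 4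
  have h5 := two_mul_sum_le_succ_mul_partitionPoly_eval hx 5
  norm_num [Finset.sum_range_succ, partitionPoly_eval_zero, partitionPoly_eval_one,
    s2, s3, s4, s5, s6] at h1 h2 h3 h4 h5
  refine ⟨?_, ?_, ?_, ?_, ?_⟩ <;> linarith

theorem sum_range_succ_mul_sq_add_one (a : ℝ) (M : ℕ) :
    ∑ k ∈ Finset.range M, ((k : ℝ) + 1) * ((a - k) ^ 2 + 1) =
      (a ^ 2 + 1) * (M * (M + 1) / 2) - 2 * a * ((M - 1) * M * (M + 1) / 3) +
        (M ^ 2 * (M - 1) ^ 2 / 4 + (M - 1) * M * (2 * M - 1) / 6) := by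
  induction M with
  | zero => simp
  | succ M ih =>
    rw [Finset.sum_range_succ, ih]
    push_cast
    ring

theorem le_sigma_one {k : ℕ} (hk : k ≠ 0) : k ≤ ArithmeticFunction.sigma 1 k := by
  rw [ArithmeticFunction.sigma_one_apply]
  exact Finset.single_le_sum (f := fun d => d) (fun _ _ => Nat.zero_le _)
    (Nat.mem_divisors_self k hk)

theorem two_mul_sigma_one_le (k : ℕ) : 2 * ArithmeticFunction.sigma 1 k ≤ k * (k + 1) := by
  rw [ArithmeticFunction.sigma_one_apply]
  have h : ∑ d ∈ k.divisors, d ≤ ∑ d ∈ Finset.range (k + 1), d :=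
    Finset.sum_le_sum_of_subset fun d hd =>
      Finset.mem_range.2 (Nat.lt_succ_of_le (Nat.divisor_le hd))
  have h2 := Finset.sum_range_id_mul_two (k + 1)
  simp only [Nat.add_sub_cancel] at h2
  nlinarith

/-- Bootstrapping: inserting `σ(k) ≥ k` and a quadratic lower bound into the recursion gains one
degree. -/
theorem cubic_le_partitionPoly_eval {x : ℝ} (hx : 2 ≤ x) (n : ℕ)
    (h : ∀ m ≤ n, (m : ℝ) ^ 2 + 1 ≤ (partitionPoly m).eval x) :
    ((n : ℝ) + 1) * (((n : ℝ) + 1) ^ 2 - 1) / 6 + n + 2 ≤ (partitionPoly (n + 1)).eval x := by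
  have h1 : ∑ k ∈ Finset.range (n + 1), ((k : ℝ) + 1) * (((n : ℝ) - k) ^ 2 + 1) ≤
      ∑ k ∈ Finset.range (n + 1),
        (ArithmeticFunction.sigma 1 (k + 1) : ℝ) * (partitionPoly (n - k)).eval x := by
    refine Finset.sum_le_sum fun k hk => ?_
    have hk' : k ≤ n := Nat.lt_succ_iff.1 (Finset.mem_range.1 hk)
    have hs : (k : ℝ) + 1 ≤ (ArithmeticFunction.sigma 1 (k + 1) : ℝ) := by
      exact_mod_cast le_sigma_one (Nat.succ_ne_zero k)
    have hp := h (n - k) (Nat.sub_le _ _)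
    rw [Nat.cast_sub hk'] at hp
    exact mul_le_mul hs hp (by positivity) (Nat.cast_nonneg _)
  have h2 := two_mul_sum_le_succ_mul_partitionPoly_eval hx n
  rw [sum_range_succ_mul_sq_add_one] at h1
  push_cast at h1
  have hn : (0 : ℝ) < (n : ℝ) + 1 := by positivity
  refine le_of_mul_le_mul_left ?_ hn
  refine le_trans (le_of_eq ?_) ((mul_le_mul_of_nonneg_left h1 zero_le_two).trans h2)
  ring

theorem sq_add_one_le_partitionPoly_eval {x : ℝ} (hx : 2 ≤ x) (n : ℕ) :
    (n : ℝ) ^ 2 + 1 ≤ (partitionPoly n).eval x := by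
  induction n using Nat.strong_induction_on with
  | _ n ih =>
    obtain ⟨h2, h3, h4, -, -⟩ := partitionPoly_eval_small hx
    -- At index 5 the cubic bound equals `5 ^ 2 + 1 = 26`; at 4 it gives only 15 < 17.
    rcases lt_or_ge n 5 with hn | hn
    · interval_cases n
      · norm_num [partitionPoly_eval_zero]
      · norm_num [partitionPoly_eval_one, hx]
      all_goals norm_num; linarith
    · obtain ⟨m, rfl⟩ : ∃ m, n = m + 5 := ⟨n - 5, by omega⟩
      have h := cubic_le_partitionPoly_eval hx (m + 4) fun k hk => ih k (by omega)
      refine le_trans ?_ h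
      push_cast
      have hm : (0 : ℝ) ≤ m := Nat.cast_nonneg m
      nlinarith [mul_nonneg hm hm, mul_nonneg (mul_nonneg hm hm) hm]

theorem sigma_add_sigma_le_partitionPoly_eval {x : ℝ} (hx : 2 ≤ x) {n : ℕ} (hn : 1 ≤ n) :
    (ArithmeticFunction.sigma 1 (n + 2) : ℝ) + ArithmeticFunction.sigma 1 n ≤
      (partitionPoly (n + 1)).eval x := by
  obtain ⟨h2, h3, h4, h5, h6⟩ := partitionPoly_eval_small hx
  -- The cubic bound beats the two quadratic ones from `n = 6` on (64 against 57); at `n = 5` it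
  -- fails (42 against 43).
  rcases lt_or_ge n 6 with h | h
  · have s2 : ArithmeticFunction.sigma 1 2 = 3 := by decide
    have s3 : ArithmeticFunction.sigma 1 3 = 4 := by decide
    have s4 : ArithmeticFunction.sigma 1 4 = 7 := by decide
    have s5 : ArithmeticFunction.sigma 1 5 = 6 := by decide
    have s6 : ArithmeticFunction.sigma 1 6 = 12 := by decide
    have s7 : ArithmeticFunction.sigma 1 7 = 8 := by decide
    interval_cases n <;> norm_num [s2, s3, s4, s5, s6, s7] <;> linarith
  · obtain ⟨m, rfl⟩ : ∃ m, n = m + 6 := ⟨n - 6, by omega⟩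
    have h := cubic_le_partitionPoly_eval hx (m + 6) fun k _ =>
      sq_add_one_le_partitionPoly_eval hx k
    have e1 : (2 : ℝ) * (ArithmeticFunction.sigma 1 (m + 6 + 2) : ℝ) ≤
        ((m : ℝ) + 6 + 2) * ((m : ℝ) + 6 + 2 + 1) := by
      exact_mod_cast two_mul_sigma_one_le (m + 6 + 2)
    have e2 : (2 : ℝ) * (ArithmeticFunction.sigma 1 (m + 6) : ℝ) ≤
        ((m : ℝ) + 6) * ((m : ℝ) + 6 + 1) := by
      exact_mod_cast two_mul_sigma_one_le (m + 6)
    push_cast at h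
    have hm : (0 : ℝ) ≤ m := Nat.cast_nonneg m
    nlinarith [mul_nonneg hm hm, mul_nonneg (mul_nonneg hm hm) hm]

/-- The recursion for the differences `x P_n(x) - P_{n+1}(x)`. -/
theorem mul_partitionPoly_eval_sub_succ (n : ℕ) (x : ℝ) :
    ((n : ℝ) + 2) * (x * (partitionPoly (n + 1)).eval x - (partitionPoly (n + 2)).eval x) =
      x * ((partitionPoly (n + 1)).eval x - ArithmeticFunction.sigma 1 (n + 2) +
        ∑ k ∈ Finset.range (n + 1), (ArithmeticFunction.sigma 1 (k + 1) : ℝ) *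
          (x * (partitionPoly (n - k)).eval x - (partitionPoly (n - k + 1)).eval x)) := by
  have h1 := succ_mul_partitionPoly_eval n x
  have h2 := succ_mul_partitionPoly_eval (n + 1) x
  rw [Finset.sum_range_succ, Nat.sub_self, partitionPoly_eval_zero] at h2
  have h3 : ∑ k ∈ Finset.range (n + 1), (ArithmeticFunction.sigma 1 (k + 1) : ℝ) *
        (x * (partitionPoly (n - k)).eval x - (partitionPoly (n - k + 1)).eval x) =
      x * ∑ k ∈ Finset.range (n + 1), (ArithmeticFunction.sigma 1 (k + 1) : ℝ) *
          (partitionPoly (n - k)).eval x -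
      ∑ k ∈ Finset.range (n + 1), (ArithmeticFunction.sigma 1 (k + 1) : ℝ) *
          (partitionPoly (n + 1 - k)).eval x := by
    rw [Finset.mul_sum, ← Finset.sum_sub_distrib]
    refine Finset.sum_congr rfl fun k hk => ?_
    rw [Nat.sub_add_comm (Nat.lt_succ_iff.1 (Finset.mem_range.1 hk))]
    ring
  rw [h3]
  push_cast at h2
  linear_combination x * h1 - h2

theorem partitionPoly_eval_succ_lt {x : ℝ} (hx : 2 < x) (n : ℕ) :
    (partitionPoly (n + 3)).eval x < x * (partitionPoly (n + 2)).eval x := by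
  induction n using Nat.strong_induction_on with
  | _ n ih =>
    have h := mul_partitionPoly_eval_sub_succ (n + 1) x
    -- Splits off the terms in `D_1` and `D_0`, which the induction hypothesis does not cover.
    rw [Finset.sum_range_succ, Finset.sum_range_succ] at h
    have hS : 0 ≤ ∑ k ∈ Finset.range n, (ArithmeticFunction.sigma 1 (k + 1) : ℝ) *
        (x * (partitionPoly (n + 1 - k)).eval x - (partitionPoly (n + 1 - k + 1)).eval x) := by
      refine Finset.sum_nonneg fun k hk => mul_nonneg (Nat.cast_nonneg _) ?_
      have hk' := Finset.mem_range.1 hk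
      have := ih (n - k - 1) (by omega)
      rw [show n - k - 1 + 3 = n + 1 - k + 1 by omega,
        show n - k - 1 + 2 = n + 1 - k by omega] at this
      linarith
    rw [Nat.add_sub_cancel_left, Nat.sub_self, partitionPoly_eval_zero, zero_add,
      partitionPoly_eval_one, show 1 + 1 = 2 from rfl, partitionPoly_eval_two] at h
    have hb := sigma_add_sigma_le_partitionPoly_eval hx.le (Nat.succ_pos n)
    have hs : (1 : ℝ) ≤ ArithmeticFunction.sigma 1 (n + 1) := by
      exact_mod_cast (Nat.succ_pos n).trans_le (le_sigma_one (Nat.succ_ne_zero n))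
    -- `D_1 + 1 = (x - 1)(x - 2) / 2`, so the `D_1` term costs less than `σ(n+1)`.
    have hd : 0 < (ArithmeticFunction.sigma 1 (n + 1) : ℝ) * ((x - 1) * (x - 2)) :=
      mul_pos (by linarith) (mul_pos (by linarith) (by linarith))
    simp only [Nat.succ_eq_add_one] at hb
    have hpos : 0 < ((n + 1 : ℕ) + 2 : ℝ) *
        (x * (partitionPoly (n + 1 + 1)).eval x - (partitionPoly (n + 1 + 2)).eval x) := by
      rw [h]
      refine mul_pos (by linarith) ?_
      nlinarith
    exact sub_pos.1 (pos_of_mul_pos_right hpos (by positivity))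

theorem proposition4p1 :
    (∀ (n : ℕ) (x : ℝ), 2 ≤ n → 2 < x →
      x * (partitionPoly n).eval x > (partitionPoly (n + 1)).eval x) ∧
    (∀ x : ℝ, 3 < x →
      x * (partitionPoly 1).eval x > (partitionPoly (1 + 1)).eval x) := by
  refine ⟨fun n x hn hx => ?_, fun x hx => ?_⟩
  · obtain ⟨m, rfl⟩ : ∃ m, n = m + 2 := ⟨n - 2, by omega⟩
    exact partitionPoly_eval_succ_lt hx m
  · rw [show 1 + 1 = 2 from rfl, partitionPoly_eval_one, partitionPoly_eval_two]
    nlinarith
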